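/- Let $d\in\mathbb N$, $p\in[1,\infty)$, and let $\|\cdot\|$ be the Euclidean norm on $\mathbb R^d$. Let $\mathcal P_p(\mathbb R^d)$ be the set of Borel probability measures on $\mathbb R^d$ with finite $p$-th moment, and for $P,Q\in\mathcal P_p(\mathbb R^d)$ let $$W_p(P,Q)=\Big(\inf_{\gamma\in\Gamma(P,Q)}\int_{\mathbb R^d\times\mathbb R^d}\|x-y\|^p\,d\gamma(x,y)\Big)^{1/p},$$ where $\Gamma(P,Q)$ is the set of probability measures on $\mathbb R^d\times\mathbb R^d$ with marginals $P$ and $Q$. Let $\mathcal M\subseteq\mathcal P_p(\mathbb R^d)$ satisfy $$\lim_{r\to\infty}\ \sup_{P\in\mathcal M}\int_{\|x\|>r}\|x\|^p\,dP(x)=0 .$$ For $n\ge 1$ let $\widehat P_n=n^{-1}\sum_{i=1}^n\delta_{X_i}$ be the empirical measure of an independent sample $X_1,\dots,X_n$ from $P$, and let $\mathbb E_P$ denote expectation under the law $P^{n}$ of the sample. Then, for all $P\in\mathcal M$ and $n\ge1$, $W_p^p(\widehat P_n,P)$ is a Borel measurable function of $(X_1,\dots,X_n)$, and $$\lim_{n\to\infty}\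 \sup_{P\in\mathcal M}\mathbb E_P\big\{W_p^p(\widehat P_n,P)\big\}=0 .$$ (Suprema over the empty family are $0$.) -/

import Mathlib

open MeasureTheory Filter Topology
open scoped ENNReal

namespace EmpWass

noncomputable section

/-- The set of couplings of `μ` and `ν`: probability measures on the product space whose
first marginal is `μ` and whose second marginal is `ν`. -/
def couplings {E : Type*} [MeasurableSpace E] (μ ν : Measure E) : Set (Measure (E × E)) :=
  {γ | IsProbabilityMeasure γ ∧ γ.map Prod.fst = μ ∧ γ.map Prod.snd = ν}

/-- The `p`-Wasserstein distance of `μ` and `ν`, as an extended nonnegative real number.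
It is finite when both are probability measures with a finite moment of order `p`. -/
def wasserstein {E : Type*} [NormedAddCommGroup E] [MeasurableSpace E]
    (p : ℝ) (μ ν : Measure E) : ℝ≥0∞ :=
  (⨅ γ ∈ couplings μ ν, ∫⁻ z, ‖z.1 - z.2‖ₑ ^ p ∂γ) ^ (1 / p)

/-- The set of probability measures with a finite moment of order `p`. -/
def probP (E : Type*) [NormedAddCommGroup E] [MeasurableSpace E] (p : ℝ) :
    Set (ProbabilityMeasure E) :=
  {P | ∫⁻ x, ‖x‖ₑ ^ p ∂(P : Measure E) < ∞}

/-- The empirical measure `n⁻¹ ∑ δ_{x i}` of the sample `x 0, …, x (n - 1)`. -/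
def empirical {E : Type*} [MeasurableSpace E] {n : ℕ} (x : Fin n → E) : Measure E :=
  (n : ℝ≥0∞)⁻¹ • ∑ i, Measure.dirac (x i)

/-- The expectation of the `p`-th power of the `p`-Wasserstein distance between `P` and the
empirical measure of `n` independent observations from `P`. The sample has law `P ^ n`, the
product measure on `Fin n → E`. -/
def expectedWass {E : Type*} [NormedAddCommGroup E] [MeasurableSpace E]
    (p : ℝ) (n : ℕ) (P : ProbabilityMeasure E) : ℝ≥0∞ :=
  ∫⁻ x : Fin n → E, wasserstein p (empirical x) (P : Measure E) ^ p
    ∂(Measure.pi fun _ : Fin n => (P : Measure E))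

end

end EmpWass

/-! Cut a large closed ball of radius `R` into finitely many disjoint cells of diameter at most `ε`.
A coupling of the empirical measure with `P` that keeps the common mass of each cell inside that
cell pays at most `ε ^ p` for it. The remaining mass is paid for by `p`-th moments: the tails of
both measures outside the ball, plus `R ^ p` times the discrepancies of the cell masses
(`transportCost_le_of_cells`). In expectation the empirical tail is the tail of `P`, and each
discrepancy is at most `n ^ (-1/2)` by a variance bound. The resulting bound sees `P` only through
its tail, which is uniformly small over `M`, so choosing `ε`, then `R`, then `n` gives the limit
(`expectedWass_le_of_cells`). Measurability is separate: a coupling with an empirical measure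
amounts to writing `P` as an average of `n` probability measures, so the cost is an infimum of
continuous functions of the sample. -/

namespace EmpWass

/-! ### Transport from an empirical measure, and measurability of the cost. -/

section Transport

variable {E : Type*} [NormedAddCommGroup E] [MeasurableSpace E]

/-- The optimal transport cost between `μ` and `ν` for the cost `‖x - y‖ ^ p`. -/
noncomputable def transportCost (p : ℝ) (μ ν : Measure E) : ℝ≥0∞ :=
  ⨅ γ ∈ couplings μ ν, ∫⁻ z, ‖z.1 - z.2‖ₑ ^ p ∂γ

theorem wasserstein_rpow {p : ℝ} (hp : p ≠ 0) (μ ν : Measure E) :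
    wasserstein p μ ν ^ p = transportCost p μ ν := by
  rw [wasserstein, transportCost, ← ENNReal.rpow_mul, one_div, inv_mul_cancel₀ hp,
    ENNReal.rpow_one]

theorem enorm_sub_rpow_le {F : Type*} [NormedAddCommGroup F] {p : ℝ} (hp : 1 ≤ p) (x y : F) :
    ‖x - y‖ₑ ^ p ≤ 2 ^ (p - 1) * (‖x‖ₑ ^ p + ‖y‖ₑ ^ p) :=
  (ENNReal.rpow_le_rpow enorm_sub_le (by linarith)).trans
    (ENNReal.rpow_add_le_mul_rpow_add_rpow _ _ hp)

theorem two_rpow_ne_top (q : ℝ) : (2 : ℝ≥0∞) ^ q ≠ ∞ := by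
  simp [ENNReal.rpow_eq_top_iff]

theorem continuous_lintegral_enorm_sub_rpow [BorelSpace E] [SecondCountableTopology E]
    {p : ℝ} (hp : 1 ≤ p) (μ : Measure E) [IsFiniteMeasure μ] (hμ : ∫⁻ y, ‖y‖ₑ ^ p ∂μ ≠ ∞) :
    Continuous fun x : E => ∫⁻ y, ‖x - y‖ₑ ^ p ∂μ := by
  have hp0 : 0 ≤ p := by linarith
  refine continuous_iff_continuousAt.2 fun x₀ => ?_
  refine tendsto_lintegral_filter_of_dominated_convergence
    (fun y => 2 ^ (p - 1) * ((‖x₀‖ₑ + 1) ^ p + ‖y‖ₑ ^ p)) ?_ ?_ ?_ ?_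
  · exact Eventually.of_forall fun x => by fun_prop
  · have h : ∀ᶠ x in 𝓝 x₀, ‖x‖ₑ < ‖x₀‖ₑ + 1 :=
      continuous_enorm.continuousAt.eventually_lt continuousAt_const
        (ENNReal.lt_add_right enorm_ne_top one_ne_zero)
    filter_upwards [h] with x hx
    refine Eventually.of_forall fun y => (enorm_sub_rpow_le hp x y).trans ?_
    gcongr
  · rw [lintegral_const_mul' _ _ (two_rpow_ne_top _), lintegral_add_left measurable_const,
      lintegral_const]
    refine ENNReal.mul_ne_top (two_rpow_ne_top _) (ENNReal.add_ne_top.2 ⟨?_, hμ⟩)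
    refine ENNReal.mul_ne_top (ENNReal.rpow_ne_top_of_nonneg hp0 ?_) (measure_ne_top _ _)
    simp
  · refine Eventually.of_forall fun y => ?_
    have : Continuous fun x : E => ‖x - y‖ₑ ^ p :=
      ENNReal.continuous_rpow_const.comp (by fun_prop)
    exact this.tendsto x₀

theorem lintegral_empirical {F : Type*} [MeasurableSpace F] {n : ℕ} (x : Fin n → F)
    {f : F → ℝ≥0∞} (hf : Measurable f) :
    ∫⁻ y, f y ∂(empirical x) = (n : ℝ≥0∞)⁻¹ * ∑ i, f (x i) := by
  rw [empirical, lintegral_smul_measure, lintegral_finsetSum_measure, smul_eq_mul]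
  simp_rw [lintegral_dirac' _ hf]

theorem empirical_apply {F : Type*} [MeasurableSpace F] {n : ℕ} (x : Fin n → F)
    {A : Set F} (hA : MeasurableSet A) :
    empirical x A = (n : ℝ≥0∞)⁻¹ * ∑ i, A.indicator 1 (x i) := by
  rw [← lintegral_indicator_one hA, lintegral_empirical x (measurable_one.indicator hA)]

theorem isProbabilityMeasure_empirical {F : Type*} [MeasurableSpace F] {n : ℕ} (hn : 0 < n)
    (x : Fin n → F) : IsProbabilityMeasure (empirical x) := by
  refine ⟨?_⟩
  rw [empirical_apply x MeasurableSet.univ]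
  simp [ENNReal.inv_mul_cancel, hn.ne']

/-- The families of `n` probability measures whose average is `P`. -/
def splittings {F : Type*} [MeasurableSpace F] (n : ℕ) (P : Measure F) :
    Set (Fin n → Measure F) :=
  {μ | (∀ i, IsProbabilityMeasure (μ i)) ∧ (n : ℝ≥0∞)⁻¹ • ∑ i, μ i = P}

theorem map_finset_sum {α β ι : Type*} [MeasurableSpace α] [MeasurableSpace β] {f : α → β}
    (hf : Measurable f) (s : Finset ι) (μ : ι → Measure α) :
    (∑ i ∈ s, μ i).map f = ∑ i ∈ s, (μ i).map f := by
  simp_rw [← Measure.mapₗ_apply_of_measurable hf, map_sum]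

/-- Averaging the products of `δ_{x i}` and `μ i` gives a coupling. Conversely, disintegrating a
coupling over its first marginal gives a splitting by the conditional laws at the `x i`; repeated
sample points share one law, which is harmless. -/
theorem transportCost_empirical [BorelSpace E] [StandardBorelSpace E]
    [SecondCountableTopology E] (p : ℝ) {n : ℕ} (hn : 0 < n) (x : Fin n → E) (P : Measure E) :
    transportCost p (empirical x) P =
      ⨅ μ ∈ splittings n P, (n : ℝ≥0∞)⁻¹ * ∑ i, ∫⁻ y, ‖x i - y‖ₑ ^ p ∂(μ i) := by
  have hc : Measurable fun z : E × E => ‖z.1 - z.2‖ₑ ^ p := by fun_prop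
  have := isProbabilityMeasure_empirical hn x
  apply le_antisymm
  · refine le_iInf₂ fun μ ⟨hμ, hs⟩ => ?_
    set γ : Measure (E × E) := (n : ℝ≥0∞)⁻¹ • ∑ i, (Measure.dirac (x i)).prod (μ i) with hγ
    have h1 : γ.map Prod.fst = empirical x := by
      rw [hγ, Measure.map_smul, map_finset_sum measurable_fst, empirical]
      simp
    have h2 : γ.map Prod.snd = P := by
      rw [hγ, Measure.map_smul, map_finset_sum measurable_snd, ← hs]
      simp
    have h3 : IsProbabilityMeasure γ := by
      have : IsProbabilityMeasure (γ.map Prod.fst) := h1 ▸ inferInstance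
      exact (Measure.isProbabilityMeasure_map_iff measurable_fst.aemeasurable).1 this
    refine (iInf₂_le γ ⟨h3, h1, h2⟩).trans_eq ?_
    rw [hγ, lintegral_smul_measure, lintegral_finsetSum_measure, smul_eq_mul]
    congr 1
    refine Finset.sum_congr rfl fun i _ => ?_
    rw [lintegral_prod _ hc.aemeasurable, lintegral_dirac' _ hc.lintegral_prod_right']
  · refine le_iInf₂ fun γ ⟨h3, h1, h2⟩ => ?_
    have hne : Nonempty E := ⟨x ⟨0, hn⟩⟩
    have hd : (empirical x).compProd γ.condKernel = γ := by
      rw [← h1]; exact γ.disintegrate γ.condKernel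
    have hs : (fun i => γ.condKernel (x i)) ∈ splittings n P := by
      refine ⟨fun i => inferInstance, ?_⟩
      ext A hA
      have : P A = ∫⁻ a, γ.condKernel a A ∂(empirical x) := by
        rw [← h2, Measure.map_apply measurable_snd hA]
        conv_lhs => rw [← hd]
        rw [Measure.compProd_apply (measurable_snd hA)]
        rfl
      rw [this, lintegral_empirical x (γ.condKernel.measurable_coe hA)]
      simp
    refine (iInf₂_le _ hs).trans_eq ?_
    conv_rhs => rw [← hd]
    rw [Measure.lintegral_compProd hc, lintegral_empirical]
    exact Measurable.lintegral_kernel_prod_right' hc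

/-- An infimum of continuous functions, even an uncountable one, is upper semicontinuous. -/
theorem measurable_transportCost_empirical [BorelSpace E] [StandardBorelSpace E]
    [SecondCountableTopology E] {p : ℝ} (hp : 1 ≤ p) {n : ℕ} (hn : 0 < n) (P : Measure E)
    (hP : ∫⁻ y, ‖y‖ₑ ^ p ∂P ≠ ∞) :
    Measurable fun x : Fin n → E => transportCost p (empirical x) P := by
  simp_rw [transportCost_empirical p hn]
  have hn' : (n : ℝ≥0∞)⁻¹ ≠ 0 := by simp
  have hn'' : (n : ℝ≥0∞)⁻¹ ≠ ∞ := by simp [hn.ne']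
  refine UpperSemicontinuous.measurable
    (upperSemicontinuous_iInf fun μ => upperSemicontinuous_iInf fun hμ => ?_)
  refine Continuous.upperSemicontinuous ?_
  refine (ENNReal.continuous_const_mul hn'').comp (continuous_finsetSum _ fun i _ => ?_)
  have := hμ.1 i
  refine (continuous_lintegral_enorm_sub_rpow hp (μ i) ?_).comp (continuous_apply i)
  -- Each `μ i` inherits a finite moment from `P`, since it enters the average with weight `1 / n`.
  intro h
  apply hP
  rw [← hμ.2, lintegral_smul_measure, lintegral_finsetSum_measure, smul_eq_mul,
    ENNReal.mul_eq_top]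
  exact Or.inl ⟨hn', ENNReal.sum_eq_top.2 ⟨i, Finset.mem_univ _, h⟩⟩

end Transport

/-! ### Product couplings of measures of equal mass. -/

section ProductCoupling

variable {α β : Type*} [MeasurableSpace α] [MeasurableSpace β]

/-- The product of two finite measures of equal mass, normalised to have them as marginals. -/
noncomputable def normProd (μ : Measure α) (ν : Measure β) : Measure (α × β) :=
  (μ Set.univ)⁻¹ • μ.prod ν

theorem inv_mass_smul {μ : Measure α} [IsFiniteMeasure μ] :
    ((μ Set.univ)⁻¹ * μ Set.univ) • μ = μ := by
  by_cases h : μ Set.univ = 0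
  -- With zero mass the factor is `∞ * 0 = 0`, and the measure itself is zero, so empty cells need
  -- no separate treatment later.
  · simp [Measure.measure_univ_eq_zero.1 h]
  · rw [ENNReal.inv_mul_cancel h (measure_ne_top _ _), one_smul]

theorem normProd_map_fst {μ : Measure α} {ν : Measure β} [IsFiniteMeasure μ] [IsFiniteMeasure ν]
    (h : μ Set.univ = ν Set.univ) : (normProd μ ν).map Prod.fst = μ := by
  rw [normProd, Measure.map_smul, Measure.map_fst_prod, ← h, smul_smul, inv_mass_smul]

theorem normProd_map_snd {μ : Measure α} {ν : Measure β} [IsFiniteMeasure μ] [IsFiniteMeasure ν]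
    (h : μ Set.univ = ν Set.univ) : (normProd μ ν).map Prod.snd = ν := by
  rw [normProd, Measure.map_smul, Measure.map_snd_prod, smul_smul, h, inv_mass_smul]

theorem lintegral_comp_fst {μ : Measure α} {ν : Measure β} [IsFiniteMeasure μ] [IsFiniteMeasure ν]
    (h : μ Set.univ = ν Set.univ) {f : α → ℝ≥0∞} (hf : Measurable f) :
    ∫⁻ z, f z.1 ∂(normProd μ ν) = ∫⁻ x, f x ∂μ := by
  conv_rhs => rw [← normProd_map_fst h, lintegral_map hf measurable_fst]

theorem lintegral_comp_snd {μ : Measure α} {ν : Measure β} [IsFiniteMeasure μ] [IsFiniteMeasure ν]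
    (h : μ Set.univ = ν Set.univ) {f : β → ℝ≥0∞} (hf : Measurable f) :
    ∫⁻ z, f z.2 ∂(normProd μ ν) = ∫⁻ y, f y ∂ν := by
  conv_rhs => rw [← normProd_map_snd h, lintegral_map hf measurable_snd]

theorem lintegral_normProd_le {μ : Measure α} {ν : Measure β}
    [IsFiniteMeasure μ] [IsFiniteMeasure ν] (h : μ Set.univ = ν Set.univ)
    {f : α × β → ℝ≥0∞} {c : ℝ≥0∞} {A : Set α} {B : Set β}
    (hμ : ∀ᵐ x ∂μ, x ∈ A) (hν : ∀ᵐ y ∂ν, y ∈ B) (hf : ∀ x ∈ A, ∀ y ∈ B, f (x, y) ≤ c) :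
    ∫⁻ z, f z ∂(normProd μ ν) ≤ c * μ Set.univ := by
  have h1 : ∀ᵐ z ∂(normProd μ ν), f z ≤ c := by
    have h2 : ∀ᵐ z ∂(normProd μ ν), z.1 ∈ A := by
      rw [← normProd_map_fst h] at hμ
      exact ae_of_ae_map measurable_fst.aemeasurable hμ
    have h3 : ∀ᵐ z ∂(normProd μ ν), z.2 ∈ B := by
      rw [← normProd_map_snd h] at hν
      exact ae_of_ae_map measurable_snd.aemeasurable hν
    filter_upwards [h2, h3] with z hz hz' using hf _ hz _ hz'
  refine (lintegral_mono_ae h1).trans_eq ?_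
  rw [lintegral_const, ← normProd_map_fst h, Measure.map_apply measurable_fst MeasurableSet.univ,
    Set.preimage_univ, normProd_map_fst h]

end ProductCoupling

/-! ### The coupling that keeps common mass within cells. -/

section CellCoupling

variable {E : Type*} [MeasurableSpace E]

/-- The part of `μ|_A` which has mass `min (μ A) (ν A)`. -/
noncomputable def commonPart (μ ν : Measure E) (A : Set E) : Measure E :=
  (min (μ A) (ν A) / μ A) • μ.restrict A

/-- The part of `μ|_A` which is left over by `commonPart μ ν A`. -/
noncomputable def excessPart (μ ν : Measure E) (A : Set E) : Measure E :=
  (1 - min (μ A) (ν A) / μ A) • μ.restrict A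

theorem min_div_le_one (a b : ℝ≥0∞) : min a b / a ≤ 1 :=
  ENNReal.div_le_of_le_mul (by simp)

theorem min_div_mul_cancel {a : ℝ≥0∞} (ha : a ≠ ∞) (b : ℝ≥0∞) : min a b / a * a = min a b := by
  by_cases h : a = 0
  · simp [h]
  · exact ENNReal.div_mul_cancel h ha

theorem commonPart_add_excessPart (μ ν : Measure E) (A : Set E) :
    commonPart μ ν A + excessPart μ ν A = μ.restrict A := by
  rw [commonPart, excessPart, ← add_smul, add_tsub_cancel_of_le (min_div_le_one _ _), one_smul]

theorem commonPart_univ (μ ν : Measure E) [IsFiniteMeasure μ] (A : Set E) :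
    commonPart μ ν A Set.univ = min (μ A) (ν A) := by
  simp [commonPart, min_div_mul_cancel (measure_ne_top μ A)]

theorem excessPart_univ (μ ν : Measure E) [IsFiniteMeasure μ] (A : Set E) :
    excessPart μ ν A Set.univ = μ A - ν A := by
  have h := congrArg (fun m : Measure E => m Set.univ) (commonPart_add_excessPart μ ν A)
  simp only [Measure.coe_add, Pi.add_apply, commonPart_univ, Measure.restrict_apply_univ] at h
  have hne : min (μ A) (ν A) ≠ ∞ := ne_top_of_le_ne_top (measure_ne_top μ A) (min_le_left _ _)
  rw [ENNReal.eq_sub_of_add_eq hne ((add_comm _ _).trans h)]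
  rcases le_total (μ A) (ν A) with h' | h'
  · rw [min_eq_left h', tsub_self, tsub_eq_zero_of_le h']
  · rw [min_eq_right h']

instance (μ ν : Measure E) [IsFiniteMeasure μ] (A : Set E) :
    IsFiniteMeasure (commonPart μ ν A) :=
  ⟨by rw [commonPart_univ]; exact (min_le_left _ _).trans_lt (measure_lt_top μ A)⟩

instance (μ ν : Measure E) [IsFiniteMeasure μ] (A : Set E) :
    IsFiniteMeasure (excessPart μ ν A) :=
  ⟨by rw [excessPart_univ]; exact tsub_le_self.trans_lt (measure_lt_top μ A)⟩

theorem ae_mem_commonPart (μ ν : Measure E) {A : Set E} (hA : MeasurableSet A) :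
    ∀ᵐ x ∂(commonPart μ ν A), x ∈ A :=
  Measure.ae_smul_measure (ae_restrict_mem hA) _

theorem ae_mem_excessPart (μ ν : Measure E) {A : Set E} (hA : MeasurableSet A) :
    ∀ᵐ x ∂(excessPart μ ν A), x ∈ A :=
  Measure.ae_smul_measure (ae_restrict_mem hA) _

variable {ι : Type*} [Fintype ι]

/-- What is left of `μ` when the common parts with `ν` in the cells `A i` are removed. -/
noncomputable def remainder (μ ν : Measure E) (A : ι → Set E) : Measure E :=
  μ.restrict (⋃ i, A i)ᶜ + ∑ i, excessPart μ ν (A i)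

instance (μ ν : Measure E) [IsFiniteMeasure μ] (A : ι → Set E) :
    IsFiniteMeasure (remainder μ ν A) := by
  unfold remainder; infer_instance

theorem sum_commonPart_add_remainder (μ ν : Measure E) {A : ι → Set E}
    (hA : ∀ i, MeasurableSet (A i)) (hd : Pairwise (Function.onFun Disjoint A)) :
    ∑ i, commonPart μ ν (A i) + remainder μ ν A = μ := by
  rw [remainder, add_left_comm, ← Finset.sum_add_distrib]
  simp_rw [commonPart_add_excessPart]
  rw [← Measure.sum_fintype, ← Measure.restrict_iUnion hd hA, add_comm,
    Measure.restrict_add_restrict_compl (MeasurableSet.iUnion hA)]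

/-- Both sides are what is left of mass `1` after removing the symmetric sum of the `min (μ (A i))
(ν (A i))`. This allows the remainders to be coupled by `normProd`. -/
theorem remainder_univ (μ ν : Measure E) [IsProbabilityMeasure μ] [IsProbabilityMeasure ν]
    {A : ι → Set E} (hA : ∀ i, MeasurableSet (A i)) (hd : Pairwise (Function.onFun Disjoint A)) :
    remainder μ ν A Set.univ = remainder ν μ A Set.univ := by
  have h1 := congrArg (fun m : Measure E => m Set.univ) (sum_commonPart_add_remainder μ ν hA hd)
  have h2 := congrArg (fun m : Measure E => m Set.univ) (sum_commonPart_add_remainder ν μ hA hd)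
  simp only [Measure.coe_add, Pi.add_apply, Measure.finsetSum_apply, commonPart_univ,
    measure_univ] at h1 h2
  simp_rw [min_comm (ν _)] at h2
  refine (ENNReal.add_right_inj ?_).1 (h1.trans h2.symm)
  refine ENNReal.sum_ne_top.2 fun i _ => ?_
  exact ne_top_of_le_ne_top (measure_ne_top μ (A i)) (min_le_left _ _)

theorem lintegral_remainder_le (μ ν : Measure E) [IsFiniteMeasure μ] {A : ι → Set E}
    (hA : ∀ i, MeasurableSet (A i)) {f : E → ℝ≥0∞} {c : ℝ≥0∞} (hf : ∀ i, ∀ x ∈ A i, f x ≤ c) :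
    ∫⁻ x, f x ∂(remainder μ ν A) ≤
      ∫⁻ x in (⋃ i, A i)ᶜ, f x ∂μ + c * ∑ i, (μ (A i) - ν (A i)) := by
  rw [remainder, lintegral_add_measure, lintegral_finsetSum_measure, Finset.mul_sum]
  gcongr with i
  rw [← excessPart_univ, ← lintegral_const]
  refine lintegral_mono_ae ?_
  filter_upwards [ae_mem_excessPart μ ν (hA i)] with x hx using hf i x hx

/-- The coupling which keeps as much mass as possible inside each of the cells. -/
noncomputable def cellCoupling (μ ν : Measure E) (A : ι → Set E) : Measure (E × E) :=
  ∑ i, normProd (commonPart μ ν (A i)) (commonPart ν μ (A i)) +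
    normProd (remainder μ ν A) (remainder ν μ A)

theorem cellCoupling_mem_couplings (μ ν : Measure E) [IsProbabilityMeasure μ]
    [IsProbabilityMeasure ν] {A : ι → Set E} (hA : ∀ i, MeasurableSet (A i))
    (hd : Pairwise (Function.onFun Disjoint A)) : cellCoupling μ ν A ∈ couplings μ ν := by
  have hc (i : ι) : commonPart μ ν (A i) Set.univ = commonPart ν μ (A i) Set.univ := by
    rw [commonPart_univ, commonPart_univ, min_comm]
  have h1 : (cellCoupling μ ν A).map Prod.fst = μ := by
    rw [cellCoupling, Measure.map_add _ _ measurable_fst, map_finset_sum measurable_fst,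
      normProd_map_fst (remainder_univ μ ν hA hd)]
    simp_rw [normProd_map_fst (hc _)]
    exact sum_commonPart_add_remainder μ ν hA hd
  have h2 : (cellCoupling μ ν A).map Prod.snd = ν := by
    rw [cellCoupling, Measure.map_add _ _ measurable_snd, map_finset_sum measurable_snd,
      normProd_map_snd (remainder_univ μ ν hA hd)]
    simp_rw [normProd_map_snd (hc _)]
    exact sum_commonPart_add_remainder ν μ hA hd
  refine ⟨?_, h1, h2⟩
  have : IsProbabilityMeasure ((cellCoupling μ ν A).map Prod.fst) := by
    rw [h1]; infer_instance
  exact (Measure.isProbabilityMeasure_map_iff measurable_fst.aemeasurable).1 this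

end CellCoupling

/-! ### Deterministic bound on the cost, and construction of the cells. -/

section Bound

variable {E : Type*} [NormedAddCommGroup E] [MeasurableSpace E] [BorelSpace E]
  {ι : Type*} [Fintype ι]

theorem transportCost_le_of_cells {p : ℝ} (hp : 1 ≤ p) (μ ν : Measure E) [IsProbabilityMeasure μ]
    [IsProbabilityMeasure ν] {A : ι → Set E} (hA : ∀ i, MeasurableSet (A i))
    (hd : Pairwise (Function.onFun Disjoint A)) {ε R : ℝ≥0∞}
    (hε : ∀ i, ∀ x ∈ A i, ∀ y ∈ A i, ‖x - y‖ₑ ≤ ε) (hR : ∀ i, ∀ x ∈ A i, ‖x‖ₑ ≤ R) :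
    transportCost p μ ν ≤ ε ^ p + 2 ^ (p - 1) *
      ((∫⁻ x in (⋃ i, A i)ᶜ, ‖x‖ₑ ^ p ∂μ + R ^ p * ∑ i, (μ (A i) - ν (A i))) +
        (∫⁻ x in (⋃ i, A i)ᶜ, ‖x‖ₑ ^ p ∂ν + R ^ p * ∑ i, (ν (A i) - μ (A i)))) := by
  have hp0 : 0 ≤ p := by linarith
  have hm : Measurable fun x : E => ‖x‖ₑ ^ p := by fun_prop
  have hr := remainder_univ μ ν hA hd
  have hm1 : Measurable fun z : E × E => ‖z.1‖ₑ ^ p := hm.comp measurable_fst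
  have h1 := lintegral_comp_fst hr hm
  have h2 := lintegral_comp_snd hr hm
  refine (iInf₂_le _ (cellCoupling_mem_couplings μ ν hA hd)).trans ?_
  rw [cellCoupling, lintegral_add_measure, lintegral_finsetSum_measure]
  refine add_le_add ?_ ?_
  · calc
      _ ≤ ∑ i, ε ^ p * μ (A i) := by
        refine Finset.sum_le_sum fun i _ => ?_
        refine (lintegral_normProd_le (c := ε ^ p) ?_ (ae_mem_commonPart μ ν (hA i))
          (ae_mem_commonPart ν μ (hA i)) fun x hx y hy => ?_).trans ?_
        · rw [commonPart_univ, commonPart_univ, min_comm]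
        · exact ENNReal.rpow_le_rpow (hε i x hx y hy) hp0
        · rw [commonPart_univ]
          gcongr
          exact min_le_left _ _
      _ = ε ^ p * μ (⋃ i, A i) := by
        rw [← Finset.mul_sum, measure_iUnion hd hA, tsum_fintype]
      _ ≤ ε ^ p := mul_le_of_le_one_right' prob_le_one
  · refine (lintegral_mono fun z : E × E => enorm_sub_rpow_le hp z.1 z.2).trans ?_
    rw [lintegral_const_mul' _ _ (two_rpow_ne_top _),
      lintegral_add_left hm1, h1, h2]
    gcongr
    · exact lintegral_remainder_le μ ν hA fun i x hx => ENNReal.rpow_le_rpow (hR i x hx) hp0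
    · exact lintegral_remainder_le ν μ hA fun i x hx => ENNReal.rpow_le_rpow (hR i x hx) hp0

theorem exists_cells [ProperSpace E] (R : ℝ) {ε : ℝ} (hε : 0 < ε) :
    ∃ (n : ℕ) (A : Fin n → Set E), (∀ i, MeasurableSet (A i)) ∧
      Pairwise (Function.onFun Disjoint A) ∧
      (∀ i, ∀ x ∈ A i, ∀ y ∈ A i, ‖x - y‖ₑ ≤ ENNReal.ofReal ε) ∧
      ⋃ i, A i = Metric.closedBall 0 R := by
  obtain ⟨t, ht, hcov⟩ := Metric.totallyBounded_iff.1
    (isCompact_closedBall (0 : E) R).totallyBounded (ε / 2) (half_pos hε)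
  obtain ⟨n, c, -, hc⟩ := ht.fin_param
  -- Radius `ε / 2` gives diameter at most `ε`; intersecting with the closed ball makes the union
  -- exactly that ball.
  let B (i : Fin n) : Set E := Metric.closedBall 0 R ∩ Metric.ball (c i) (ε / 2)
  have hB (i) : MeasurableSet (B i) := measurableSet_closedBall.inter measurableSet_ball
  refine ⟨n, disjointed B, fun i => ?_, disjoint_disjointed B, ?_, ?_⟩
  · rw [disjointed_apply, Finset.sup_set_eq_biUnion]
    exact (hB i).diff (Finset.measurableSet_biUnion _ fun j _ => hB j)
  · intro i x hx y hy
    have hx' := (disjointed_le B i hx).2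
    have hy' := (disjointed_le B i hy).2
    rw [← edist_eq_enorm_sub, edist_dist]
    refine ENNReal.ofReal_le_ofReal ?_
    have := dist_triangle_right x y (c i)
    rw [Metric.mem_ball] at hx' hy'
    linarith
  · rw [iUnion_disjointed]
    refine subset_antisymm (Set.iUnion_subset fun i => Set.inter_subset_left) fun x hx => ?_
    obtain ⟨y, hy, hxy⟩ := Set.mem_iUnion₂.1 (hcov hx)
    rw [← hc] at hy
    obtain ⟨i, rfl⟩ := hy
    exact Set.mem_iUnion.2 ⟨i, hx, hxy⟩

end Bound

/-! ### Mean and fluctuation of empirical cell masses. -/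

section Sampling

variable {F : Type*} [MeasurableSpace F] (P : Measure F) [IsProbabilityMeasure P]

theorem lintegral_pi_comp_eval {n : ℕ} (i : Fin n) {f : F → ℝ≥0∞} (hf : Measurable f) :
    ∫⁻ x : Fin n → F, f (x i) ∂(Measure.pi fun _ => P) = ∫⁻ y, f y ∂P :=
  (measurePreserving_eval (fun _ : Fin n => P) i).lintegral_comp hf

theorem lintegral_lintegral_empirical {n : ℕ} (hn : 0 < n) {f : F → ℝ≥0∞} (hf : Measurable f) :
    ∫⁻ x : Fin n → F, ∫⁻ y, f y ∂(empirical x) ∂(Measure.pi fun _ => P) = ∫⁻ y, f y ∂P := by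
  simp_rw [lintegral_empirical _ hf]
  rw [lintegral_const_mul' _ _ (by simp [hn.ne']), lintegral_finsetSum _ fun i _ => by fun_prop]
  simp_rw [lintegral_pi_comp_eval P _ hf]
  rw [Finset.sum_const, Finset.card_univ, Fintype.card_fin, nsmul_eq_mul, ← mul_assoc,
    ENNReal.inv_mul_cancel (by simp [hn.ne']) (by simp), one_mul]

theorem lintegral_enorm_le_rpow {Ω : Type*} [MeasurableSpace Ω] (μ : Measure Ω)
    [IsProbabilityMeasure μ] {Y : Ω → ℝ} (hY : AEStronglyMeasurable Y μ) :
    ∫⁻ ω, ‖Y ω‖ₑ ∂μ ≤ (∫⁻ ω, ‖Y ω‖ₑ ^ 2 ∂μ) ^ (1 / 2 : ℝ) := by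
  have h := eLpNorm_le_eLpNorm_of_exponent_le (μ := μ) one_le_two hY
  rw [eLpNorm_one_eq_lintegral_enorm, eLpNorm_eq_lintegral_rpow_enorm_toReal (by simp) (by simp)]
    at h
  simpa using h

/-- The frequency of the set `A` in the sample `x`. -/
noncomputable def frequency {n : ℕ} (A : Set F) (x : Fin n → F) : ℝ :=
  (∑ i : Fin n, fun x : Fin n → F => (n : ℝ)⁻¹ * A.indicator 1 (x i)) x

theorem measurable_frequency {n : ℕ} {A : Set F} (hA : MeasurableSet A) :
    Measurable (frequency A : (Fin n → F) → ℝ) := by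
  have : Measurable (A.indicator (1 : F → ℝ)) := measurable_one.indicator hA
  unfold frequency
  simp_rw [Finset.sum_apply]
  fun_prop

theorem empirical_eq_ofReal_frequency {n : ℕ} (hn : 0 < n) {A : Set F} (hA : MeasurableSet A)
    (x : Fin n → F) : empirical x A = ENNReal.ofReal (frequency A x) := by
  have h (y : F) : (0 : ℝ) ≤ A.indicator 1 y := Set.indicator_nonneg (fun _ _ => zero_le_one) y
  have hn' : (0 : ℝ) < n := by exact_mod_cast hn
  rw [empirical_apply x hA, frequency, Finset.sum_apply,
    ENNReal.ofReal_sum_of_nonneg fun i _ => by have := h (x i); positivity, Finset.mul_sum]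
  refine Finset.sum_congr rfl fun i _ => ?_
  rw [ENNReal.ofReal_mul (by positivity), ENNReal.ofReal_inv_of_pos hn', ENNReal.ofReal_natCast]
  by_cases hx : x i ∈ A <;> simp [hx]

theorem memLp_indicator_one {A : Set F} (hA : MeasurableSet A) :
    MemLp (A.indicator (1 : F → ℝ)) 2 P :=
  memLp_indicator_const 2 hA 1 (Or.inr (measure_ne_top P A))

theorem integral_frequency {n : ℕ} (hn : 0 < n) {A : Set F} (hA : MeasurableSet A) :
    ∫ x : Fin n → F, frequency A x ∂(Measure.pi fun _ => P) = P.real A := by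
  have hn' : (n : ℝ) ≠ 0 := by exact_mod_cast hn.ne'
  have hm := (memLp_indicator_one P hA).aestronglyMeasurable
  simp_rw [frequency, Finset.sum_apply]
  rw [integral_finsetSum]
  · simp_rw [integral_const_mul]
    have h (i : Fin n) : ∫ x : Fin n → F, A.indicator (1 : F → ℝ) (x i) ∂(Measure.pi fun _ => P) =
        P.real A := by
      rw [integral_comp_eval (μ := fun _ : Fin n => P) hm, integral_indicator_one hA]
    simp_rw [h]
    rw [Finset.sum_const, Finset.card_univ, Fintype.card_fin, nsmul_eq_mul,
      mul_inv_cancel_left₀ hn']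
  · intro i _
    refine Integrable.const_mul ?_ _
    exact (measurePreserving_eval (fun _ : Fin n => P) i).integrable_comp_of_integrable
      ((memLp_indicator_one P hA).integrable one_le_two)

/-- For values in `[0, 1]` and mean `m`, the variance is at most `(1 - m) * m`. -/
theorem variance_indicator_le_one {A : Set F} (hA : MeasurableSet A) :
    ProbabilityTheory.variance (A.indicator (1 : F → ℝ)) P ≤ 1 := by
  have h := ProbabilityTheory.variance_le_sub_mul_sub (μ := P) (a := 0) (b := 1)
    (X := A.indicator 1) (Eventually.of_forall fun y => by by_cases hy : y ∈ A <;> simp [hy])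
    (memLp_indicator_one P hA).aestronglyMeasurable.aemeasurable
  rw [integral_indicator_one hA] at h
  nlinarith [measureReal_nonneg (μ := P) (s := A), measureReal_le_one (μ := P) (s := A)]

theorem lintegral_enorm_frequency_sub_sq_le {n : ℕ} (hn : 0 < n) {A : Set F}
    (hA : MeasurableSet A) :
    ∫⁻ x : Fin n → F, ‖frequency A x - P.real A‖ₑ ^ 2 ∂(Measure.pi fun _ => P) ≤
      (n : ℝ≥0∞)⁻¹ := by
  have hn' : (0 : ℝ) < n := by exact_mod_cast hn
  have hm : MemLp (fun y => (n : ℝ)⁻¹ * A.indicator (1 : F → ℝ) y) 2 P :=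
    (memLp_indicator_one P hA).const_mul _
  have hL : MemLp (frequency A : (Fin n → F) → ℝ) 2 (Measure.pi fun _ => P) :=
    memLp_finsetSum' _ fun i _ =>
      hm.comp_measurePreserving (measurePreserving_eval (fun _ : Fin n => P) i)
  have hv : ProbabilityTheory.variance (frequency A : (Fin n → F) → ℝ) (Measure.pi fun _ => P) ≤
      (n : ℝ)⁻¹ := by
    have := ProbabilityTheory.variance_sum_pi (ι := Fin n) (μ := fun _ => P) fun _ => hm
    -- The summands depend on distinct coordinates, so under the product measure their variances
    -- add.
    rw [show (frequency A : (Fin n → F) → ℝ) = ∑ i : Fin n, fun x : Fin n → F =>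
      (n : ℝ)⁻¹ * A.indicator 1 (x i) from rfl, this]
    simp_rw [ProbabilityTheory.variance_const_mul]
    rw [Finset.sum_const, Finset.card_univ, Fintype.card_fin, nsmul_eq_mul]
    calc (n : ℝ) * ((n : ℝ)⁻¹ ^ 2 * _) ≤ n * ((n : ℝ)⁻¹ ^ 2 * 1) := by
          gcongr
          exact variance_indicator_le_one P hA
      _ = (n : ℝ)⁻¹ := by field_simp
  have h := ENNReal.ofReal_le_ofReal hv
  rwa [ProbabilityTheory.ofReal_variance hL, ENNReal.ofReal_inv_of_pos hn',
    ENNReal.ofReal_natCast, ProbabilityTheory.evariance, integral_frequency P hn hA] at h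

theorem lintegral_enorm_frequency_sub_le {n : ℕ} (hn : 0 < n) {A : Set F}
    (hA : MeasurableSet A) :
    ∫⁻ x : Fin n → F, ‖frequency A x - P.real A‖ₑ ∂(Measure.pi fun _ => P) ≤
      (n : ℝ≥0∞)⁻¹ ^ (1 / 2 : ℝ) := by
  refine (lintegral_enorm_le_rpow _
    ((measurable_frequency hA).sub_const _).aestronglyMeasurable).trans ?_
  exact ENNReal.rpow_le_rpow (lintegral_enorm_frequency_sub_sq_le P hn hA) (by norm_num)

theorem ofReal_sub_ofReal_le_enorm (a : ℝ) {b : ℝ} (hb : 0 ≤ b) :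
    ENNReal.ofReal a - ENNReal.ofReal b ≤ ‖a - b‖ₑ := by
  rw [← ENNReal.ofReal_sub _ hb, Real.enorm_eq_ofReal_abs]
  exact ENNReal.ofReal_le_ofReal (le_abs_self _)

theorem frequency_nonneg {G : Type*} {n : ℕ} (A : Set G) (x : Fin n → G) : 0 ≤ frequency A x := by
  rw [frequency, Finset.sum_apply]
  refine Finset.sum_nonneg fun i _ => mul_nonneg (by positivity) ?_
  exact Set.indicator_nonneg (fun _ _ => zero_le_one) _

theorem lintegral_empirical_sub_le {n : ℕ} (hn : 0 < n) {A : Set F} (hA : MeasurableSet A) :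
    ∫⁻ x : Fin n → F, (empirical x A - P A) ∂(Measure.pi fun _ => P) ≤
      (n : ℝ≥0∞)⁻¹ ^ (1 / 2 : ℝ) := by
  refine (lintegral_mono fun x => ?_).trans (lintegral_enorm_frequency_sub_le P hn hA)
  rw [empirical_eq_ofReal_frequency hn hA, ← ofReal_measureReal (μ := P)]
  exact ofReal_sub_ofReal_le_enorm _ measureReal_nonneg

theorem lintegral_sub_empirical_le {n : ℕ} (hn : 0 < n) {A : Set F} (hA : MeasurableSet A) :
    ∫⁻ x : Fin n → F, (P A - empirical x A) ∂(Measure.pi fun _ => P) ≤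
      (n : ℝ≥0∞)⁻¹ ^ (1 / 2 : ℝ) := by
  refine (lintegral_mono fun x => ?_).trans (lintegral_enorm_frequency_sub_le P hn hA)
  rw [empirical_eq_ofReal_frequency hn hA, ← ofReal_measureReal (μ := P), ← enorm_neg, neg_sub]
  exact ofReal_sub_ofReal_le_enorm _ (frequency_nonneg A x)

theorem measurable_empirical_apply {n : ℕ} {A : Set F} (hA : MeasurableSet A) :
    Measurable fun x : Fin n → F => empirical x A := by
  have : Measurable (A.indicator (1 : F → ℝ≥0∞)) := measurable_one.indicator hA
  simp_rw [empirical_apply _ hA]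
  fun_prop

end Sampling

/-! ### Expected cost and the uniform limit. -/

section Expectation

variable {E : Type*} [NormedAddCommGroup E] [MeasurableSpace E] [BorelSpace E]
  {ι : Type*} [Fintype ι]

theorem expectedWass_le_of_cells {p : ℝ} (hp : 1 ≤ p) {n : ℕ} (hn : 0 < n)
    (P : ProbabilityMeasure E) {A : ι → Set E} (hA : ∀ i, MeasurableSet (A i))
    (hd : Pairwise (Function.onFun Disjoint A)) {ε R : ℝ≥0∞}
    (hε : ∀ i, ∀ x ∈ A i, ∀ y ∈ A i, ‖x - y‖ₑ ≤ ε) (hR : ∀ i, ∀ x ∈ A i, ‖x‖ₑ ≤ R)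
    (hR' : R ≠ ∞) :
    expectedWass p n P ≤ ε ^ p + 2 ^ (p - 1) *
      (2 * (∫⁻ x in (⋃ i, A i)ᶜ, ‖x‖ₑ ^ p ∂(P : Measure E) +
        R ^ p * (Fintype.card ι * (n : ℝ≥0∞)⁻¹ ^ (1 / 2 : ℝ)))) := by
  have hRp : R ^ p ≠ ∞ := ENNReal.rpow_ne_top_of_nonneg (by linarith) hR'
  have hU : MeasurableSet (⋃ i, A i)ᶜ := (MeasurableSet.iUnion hA).compl
  have hg : Measurable ((⋃ i, A i)ᶜ.indicator fun x : E => ‖x‖ₑ ^ p) :=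
    Measurable.indicator (by fun_prop) hU
  have hm (i : ι) : Measurable fun x : Fin n → E => empirical x (A i) :=
    measurable_empirical_apply (hA i)
  have hT : Measurable fun x : Fin n → E => ∫⁻ y in (⋃ i, A i)ᶜ, ‖y‖ₑ ^ p ∂(empirical x) := by
    simp_rw [← lintegral_indicator hU, lintegral_empirical _ hg]
    fun_prop
  unfold expectedWass
  simp_rw [wasserstein_rpow (by linarith : p ≠ 0)]
  calc
    _ ≤ ∫⁻ x : Fin n → E, (ε ^ p + 2 ^ (p - 1) *
          ((∫⁻ y in (⋃ i, A i)ᶜ, ‖y‖ₑ ^ p ∂(empirical x) +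
            R ^ p * ∑ i, (empirical x (A i) - (P : Measure E) (A i))) +
          (∫⁻ y in (⋃ i, A i)ᶜ, ‖y‖ₑ ^ p ∂(P : Measure E) +
            R ^ p * ∑ i, ((P : Measure E) (A i) - empirical x (A i)))))
          ∂(Measure.pi fun _ => (P : Measure E)) := by
      -- Monotonicity of the lower integral asks for no measurability of the cost.
      refine lintegral_mono fun x => ?_
      have := isProbabilityMeasure_empirical hn x
      exact transportCost_le_of_cells hp _ _ hA hd hε hR
    _ = ε ^ p + 2 ^ (p - 1) *
          ((∫⁻ y in (⋃ i, A i)ᶜ, ‖y‖ₑ ^ p ∂(P : Measure E) +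
            R ^ p * ∑ i, ∫⁻ x : Fin n → E, (empirical x (A i) - (P : Measure E) (A i))
              ∂(Measure.pi fun _ => (P : Measure E))) +
          (∫⁻ y in (⋃ i, A i)ᶜ, ‖y‖ₑ ^ p ∂(P : Measure E) +
            R ^ p * ∑ i, ∫⁻ x : Fin n → E, ((P : Measure E) (A i) - empirical x (A i))
              ∂(Measure.pi fun _ => (P : Measure E)))) := by
      rw [lintegral_add_left measurable_const, lintegral_const, measure_univ, mul_one,
        lintegral_const_mul' _ _ (two_rpow_ne_top _), lintegral_add_left (by fun_prop),
        lintegral_add_left hT, lintegral_add_left measurable_const, lintegral_const, measure_univ,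
        mul_one, lintegral_const_mul' _ _ hRp, lintegral_const_mul' _ _ hRp,
        lintegral_finsetSum _ fun i _ => by fun_prop, lintegral_finsetSum _ fun i _ => by fun_prop]
      simp_rw [← lintegral_indicator hU]
      rw [lintegral_lintegral_empirical _ hn hg]
    _ ≤ ε ^ p + 2 ^ (p - 1) *
          ((∫⁻ y in (⋃ i, A i)ᶜ, ‖y‖ₑ ^ p ∂(P : Measure E) +
            R ^ p * ∑ _i : ι, (n : ℝ≥0∞)⁻¹ ^ (1 / 2 : ℝ)) +
          (∫⁻ y in (⋃ i, A i)ᶜ, ‖y‖ₑ ^ p ∂(P : Measure E) +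
            R ^ p * ∑ _i : ι, (n : ℝ≥0∞)⁻¹ ^ (1 / 2 : ℝ))) := by
      gcongr with i _ i _
      · exact lintegral_empirical_sub_le _ hn (hA i)
      · exact lintegral_sub_empirical_le _ hn (hA i)
    _ = _ := by
      rw [Finset.sum_const, Finset.card_univ, nsmul_eq_mul, two_mul]

theorem tendsto_iSup_expectedWass [ProperSpace E] {p : ℝ} (hp : 1 ≤ p)
    {M : Set (ProbabilityMeasure E)}
    (hUI : Tendsto (fun r : ℝ => ⨆ P ∈ M, ∫⁻ x in {x | r < ‖x‖}, ‖x‖ₑ ^ p ∂(P : Measure E))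
      atTop (𝓝 0)) :
    Tendsto (fun n : ℕ => ⨆ P ∈ M, expectedWass p n P) atTop (𝓝 0) := by
  have hp0 : 0 < p := by linarith
  rw [ENNReal.tendsto_nhds_zero]
  intro η hη
  -- One third each for the diameter of the cells, the tails and the sampling error.
  have hη3 : 0 < η / 3 := ENNReal.div_pos hη.ne' (by simp)
  obtain ⟨ε, hε, hε0⟩ : ∃ ε : ℝ, ENNReal.ofReal ε ^ p ≤ η / 3 ∧ 0 < ε := by
    have h : Tendsto (fun ε : ℝ => ENNReal.ofReal ε ^ p) (𝓝[>] 0) (𝓝 0) := by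
      have : Continuous fun ε : ℝ => ENNReal.ofReal ε ^ p :=
        ENNReal.continuous_rpow_const.comp ENNReal.continuous_ofReal
      simpa [hp0] using (this.tendsto 0).mono_left nhdsWithin_le_nhds
    exact ((ENNReal.tendsto_nhds_zero.1 h _ hη3).and self_mem_nhdsWithin).exists
  obtain ⟨R, hR⟩ : ∃ R : ℝ, 2 ^ (p - 1) * (2 * ⨆ P ∈ M,
      ∫⁻ x in {x | R < ‖x‖}, ‖x‖ₑ ^ p ∂(P : Measure E)) ≤ η / 3 := by
    have h := ENNReal.Tendsto.const_mul (a := 2 ^ (p - 1))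
      (ENNReal.Tendsto.const_mul (a := 2) hUI (Or.inr (by simp))) (Or.inr (two_rpow_ne_top _))
    simp only [mul_zero] at h
    exact (ENNReal.tendsto_nhds_zero.1 h _ hη3).exists
  obtain ⟨K, A, hA, hd, hdiam, hU⟩ := exists_cells (E := E) R hε0
  have hball (i : Fin K) : ∀ x ∈ A i, ‖x‖ₑ ≤ ENNReal.ofReal R := fun x hx => by
    have : x ∈ Metric.closedBall (0 : E) R := hU ▸ Set.mem_iUnion_of_mem i hx
    rw [← ofReal_norm]
    exact ENNReal.ofReal_le_ofReal (mem_closedBall_zero_iff.1 this)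
  have hU' : (⋃ i, A i)ᶜ = {x | R < ‖x‖} := by
    ext x; simp [hU]
  have hlim : Tendsto (fun n : ℕ => 2 ^ (p - 1) * (2 * (ENNReal.ofReal R ^ p *
      (Fintype.card (Fin K) * (n : ℝ≥0∞)⁻¹ ^ (1 / 2 : ℝ))))) atTop (𝓝 0) := by
    have h : Tendsto (fun n : ℕ => (n : ℝ≥0∞)⁻¹ ^ (1 / 2 : ℝ)) atTop (𝓝 0) := by
      have := (ENNReal.continuous_rpow_const (y := 1 / 2)).tendsto 0 |>.comp
        ENNReal.tendsto_inv_nat_nhds_zero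
      simpa [Function.comp_def] using this
    have h' := ENNReal.Tendsto.const_mul (a := 2 ^ (p - 1)) (ENNReal.Tendsto.const_mul (a := 2)
      (ENNReal.Tendsto.const_mul (a := ENNReal.ofReal R ^ p)
      (ENNReal.Tendsto.const_mul (a := (Fintype.card (Fin K) : ℝ≥0∞)) h (Or.inr (by simp)))
      (Or.inr (ENNReal.rpow_ne_top_of_nonneg hp0.le ENNReal.ofReal_ne_top)))
      (Or.inr (by simp))) (Or.inr (two_rpow_ne_top _))
    simpa only [mul_zero] using h'
  -- The number `K` of cells depends on `R` and `ε` only, so the threshold for `n` serves all `P ∈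
  -- M` at once.
  filter_upwards [ENNReal.tendsto_nhds_zero.1 hlim _ hη3, eventually_gt_atTop 0] with n hn hn0
  refine iSup₂_le fun P hP => ?_
  refine (expectedWass_le_of_cells hp hn0 P hA hd hdiam hball ENNReal.ofReal_ne_top).trans ?_
  rw [hU', mul_add, mul_add]
  calc
    _ ≤ η / 3 + (η / 3 + η / 3) := by
      refine add_le_add hε (add_le_add (le_trans ?_ hR) hn)
      gcongr
      exact le_iSup₂_of_le P hP le_rfl
    _ = η := by rw [← add_assoc, ENNReal.add_thirds]

end Expectation

end EmpWass

theorem mainTheorem1 (d : ℕ) (p : ℝ) (hp : 1 ≤ p)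
    (M : Set (ProbabilityMeasure (EuclideanSpace ℝ (Fin d))))
    (hM : M ⊆ EmpWass.probP (EuclideanSpace ℝ (Fin d)) p)
    (hUI : Tendsto
      (fun r : ℝ => ⨆ P ∈ M, ∫⁻ x in {x | r < ‖x‖}, ‖x‖ₑ ^ p
        ∂(P : Measure (EuclideanSpace ℝ (Fin d))))
      atTop (𝓝 0)) :
    (∀ P ∈ M, ∀ n : ℕ, 0 < n →
      Measurable (fun x : Fin n → EuclideanSpace ℝ (Fin d) =>
        EmpWass.wasserstein p (EmpWass.empirical x)
          (P : Measure (EuclideanSpace ℝ (Fin d))) ^ p)) ∧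
    Tendsto (fun n : ℕ => ⨆ P ∈ M, EmpWass.expectedWass p n P) atTop (𝓝 0) := by
  refine ⟨fun P hP n hn => ?_, EmpWass.tendsto_iSup_expectedWass hp hUI⟩
  simp_rw [EmpWass.wasserstein_rpow (by linarith : p ≠ 0)]
  exact EmpWass.measurable_transportCost_empirical hp hn _ (hM hP).ne
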